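/- **Setting.** Let $X$ be a set. A *reproducing kernel* on a set $A$ is a symmetric function $K:A\times A\to\mathbb R$ with $\sum_{i,j}\alpha_i\alpha_jK(x_i,x_j)\ge 0$ for all finite families $\alpha_i\in\mathbb R$, $x_i\in A$; $\mathcal H(K)$ is its reproducing kernel Hilbert space of functions on $A$. A *domain* is a symmetric set $\Omega\subseteq X\times X$ that contains the diagonal. A *partially reproducing kernel* on $\Omega$ is a function $K_\Omega:\Omega\to\mathbb R$ such that $K_A:=K_\Omega|_{A\times A}$ is a reproducing kernel on $A$ for every $A\subseteq X$ with $A\times A\subseteq\Omega$. For such $A$ and $x\in A$ let $k_{x,A}=K_\Omega(x,\cdot)\in\mathcal H(K_A)$. If $(A\cup B)\times(A\cup B)\subseteq\Omega$, let $\Phi_{B,A}:\mathcal H(K_A)\to\mathcal H(K_B)$ be the unique bounded linear map that sends $k_{x,A}$ to the function $y\mapsto K_\Omega(x,y)$ on $B$ for every $x\in A$. A set $S\subseteq X$ *separates* $x,y\in X\setminus S$ in $\Omega$ if every finite path $x=z_0,z_1,\dots,z_{m+1}=y$ with all $(z_k,z_{k+1})\in\Omega$ has $z_k\in S$ for some $1\le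 k\le m$. A *completion* of $K_\Omega$ is a reproducing kernel $K$ on $X$ with $K|_\Omega=K_\Omega$. A completion $K_\star$ is *canonical* if $K_\star(x,y)=\langle K_\star(x,\cdot)|_S,\,K_\star(y,\cdot)|_S\rangle_{\mathcal H(K_\star|_{S\times S})}$ whenever $S$ separates $x$ and $y$ in $\Omega$. A *junction-tree representation* of $\Omega$ consists of a tree $\mathcal T$ on $\{1,\dots,n\}$, $n\ge1$, and sets $X_1,\dots,X_n\subseteq X$ such that (a) $X=\bigcup_jX_j$, (b) $\Omega=\bigcup_j(X_j\times X_j)$, and (c) $X_i\cap X_k\subseteq X_j$ whenever $j$ lies on the path in $\mathcal T$ from $i$ to $k$. **Theorem.** Let $K_\Omega$ be a partially reproducing kernel on a domain $\Omega$ that has a junction-tree representation by $\mathcal T$ and $X_1,\dots,X_n$. Then: 1. $K_\Omega$ has a canonical completion $K_\star$, and it is the only one. 2. For every $f\in\mathcal H(K_\star)$, the norm $\|\cdot\|_\star$ of $\mathcal H(K_\star)$ satisfies $$\|f\|_\star^2=\sum_{j=1}^n\big\|f|_{X_j}\big\|^2-\sum_{\{i,j\}\in\mathcal T}\big\|f|_{X_i\cap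 X_j}\big\|^2,$$ where each undirected edge $\{i,j\}$ of $\mathcal T$ is counted once and $\|f|_U\|$ is the norm of $f|_U$ in $\mathcal H(K_U)$. 3. If $x\in X_i$ and $y\in X_j$, and $i=i_0,i_1,\dots,i_m=j$ is the unique path in $\mathcal T$ from $i$ to $j$, then $$K_\star(x,y)=\big\langle \Phi_{i_m i_{m-1}}\cdots\Phi_{i_2i_1}\Phi_{i_1i_0}\,k_{x,X_i},\;k_{y,X_j}\big\rangle_{\mathcal H(K_{X_j})},$$ where $\Phi_{pq}=\Phi_{X_p,\,X_p\cap X_q}\,\Phi_{X_p\cap X_q,\,X_q}:\mathcal H(K_{X_q})\to\mathcal H(K_{X_p})$ for adjacent $p,q$, and the empty product ($i=j$) is the identity. -/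

import Mathlib

open scoped InnerProductSpace

/-- A (real) reproducing kernel on a set `X`: a symmetric function `X × X → ℝ` all of whose
finite quadratic forms are nonnegative. -/
@[ext]
structure ReproducingKernel (X : Type*) where
  toFun : X → X → ℝ
  symm' : ∀ x y, toFun x y = toFun y x
  nonneg' : ∀ (n : ℕ) (α : Fin n → ℝ) (x : Fin n → X),
    0 ≤ ∑ i, ∑ j, α i * α j * toFun (x i) (x j)

namespace ReproducingKernel

variable {X : Type*}

instance : CoeFun (ReproducingKernel X) (fun _ => X → X → ℝ) := ⟨toFun⟩

/-- The kernel as a matrix of operators `ℝ →L[ℝ] ℝ`, the form in which Mathlib's `RKHS` takes it. -/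
noncomputable def opMatrix (K : ReproducingKernel X) : Matrix X X (ℝ →L[ℝ] ℝ) :=
  Matrix.of fun x y => K x y • ContinuousLinearMap.id ℝ ℝ

theorem opMatrix_posSemidef (K : ReproducingKernel X) : K.opMatrix.PosSemidef := by
  have h02 := (RKHS.posSemidef_tfae (K := K.opMatrix)).out 0 2
  refine h02.mpr ⟨?_, fun v => ?_⟩
  · ext x y
    have h1 : star (ContinuousLinearMap.id ℝ ℝ) = ContinuousLinearMap.id ℝ ℝ :=
      star_one (ℝ →L[ℝ] ℝ)
    simp [opMatrix, K.symm' x y, Matrix.conjTranspose_apply, h1]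
  · have h := K.nonneg' v.support.card (fun i => v (v.support.equivFin.symm i))
      (fun i => (v.support.equivFin.symm i : X))
    have e : ∀ F : X → ℝ, ∑ i, F (v.support.equivFin.symm i : X) = ∑ x ∈ v.support, F x := by
      intro F
      rw [Equiv.sum_comp v.support.equivFin.symm (fun a : v.support => F (a : X)),
        Finset.sum_coe_sort v.support F]
    rw [e (fun x => ∑ j, v x * v (v.support.equivFin.symm j : X) *
      K x (v.support.equivFin.symm j : X))] at h
    simp_rw [fun x => e (fun y => v x * v y * K x y)] at h
    simp only [Finsupp.sum, RCLike.re_to_real]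
    refine h.trans_eq (Finset.sum_congr rfl fun x _ => Finset.sum_congr rfl fun y _ => ?_)
    simp [opMatrix, K.symm' x y]
    ring

instance (K : ReproducingKernel X) : Fact K.opMatrix.PosSemidef := ⟨K.opMatrix_posSemidef⟩

/-- The reproducing kernel Hilbert space `ℋ(K)`; its elements coerce to functions `X → ℝ`. -/
abbrev H (K : ReproducingKernel X) : Type _ := RKHS.OfKernel K.opMatrix

/-- The generator `k_x ∈ ℋ(K)`, i.e. the function `y ↦ K (x, y)`. -/
noncomputable def gen (K : ReproducingKernel X) (x : X) : K.H := RKHS.kerFun K.H x (1 : ℝ)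

theorem gen_apply (K : ReproducingKernel X) (x y : X) : K.gen x y = K x y := by
  rw [gen, RKHS.kerFun_apply, RKHS.OfKernel.kernel_ofKernel]
  simp [opMatrix, K.symm' x y]

theorem inner_gen (K : ReproducingKernel X) (f : K.H) (x : X) : ⟪f, K.gen x⟫_ℝ = f x := by
  rw [gen, RKHS.inner_kerFun]
  simp

theorem inner_gen_gen (K : ReproducingKernel X) (x y : X) :
    ⟪K.gen x, K.gen y⟫_ℝ = K x y := by
  rw [inner_gen, gen_apply]

/-- The finite linear combinations of generators. -/
noncomputable def comb (K : ReproducingKernel X) : (X →₀ ℝ) →ₗ[ℝ] K.H :=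
  Finsupp.linearCombination ℝ K.gen

theorem comb_dense (K : ReproducingKernel X) : DenseRange K.comb := by
  have h := RKHS.kerFun_dense K.H
  rw [← Submodule.dense_iff_topologicalClosure_eq_top] at h
  refine h.mono ?_
  have : Submodule.span ℝ {f : K.H | ∃ x v, RKHS.kerFun K.H x v = f} ≤ LinearMap.range K.comb := by
    rw [Submodule.span_le]
    rintro _ ⟨x, v, rfl⟩
    refine ⟨Finsupp.single x v, ?_⟩
    simp only [comb, Finsupp.linearCombination_single, gen]
    rw [← map_smul]
    simp
  exact this

theorem norm_comb_sq {Y : Type*} (K : ReproducingKernel X) (ι : Y → X) (a : Y →₀ ℝ) :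
    ‖Finsupp.linearCombination ℝ (fun y => K.gen (ι y)) a‖ ^ 2
      = a.sum fun x r => a.sum fun y s => r * s * K (ι x) (ι y) := by
  rw [← real_inner_self_eq_norm_sq, Finsupp.linearCombination_apply]
  simp only [Finsupp.sum, sum_inner, inner_sum]
  refine Finset.sum_congr rfl fun x _ => Finset.sum_congr rfl fun y _ => ?_
  rw [real_inner_smul_left, real_inner_smul_right, inner_gen_gen, K.symm' (ι x) (ι y)]
  ring

/-- Two bounded linear maps out of `ℋ(K)` which agree on all generators are equal. -/
theorem clm_ext (K : ReproducingKernel X) {F : Type*} [NormedAddCommGroup F] [NormedSpace ℝ F]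
    {S T : K.H →L[ℝ] F} (h : ∀ x, S (K.gen x) = T (K.gen x)) : S = T := by
  refine DFunLike.coe_injective (K.comb_dense.equalizer S.continuous T.continuous ?_)
  funext a
  simp [comb, Finsupp.linearCombination_apply, map_finsuppSum, h]

/-- If `L` is the pullback of `K` along `ι`, then `l_y ↦ k_{ι y}` extends to a bounded map. -/
theorem exists_embed {Y : Type*} (L : ReproducingKernel Y) (K : ReproducingKernel X) (ι : Y → X)
    (h : ∀ y z, L y z = K (ι y) (ι z)) :
    ∃ J : L.H →L[ℝ] K.H, ∀ y, J (L.gen y) = K.gen (ι y) := by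
  have hn : ∀ a : Y →₀ ℝ, ‖Finsupp.linearCombination ℝ (fun y => K.gen (ι y)) a‖ ≤
      1 * ‖L.comb a‖ := by
    intro a
    rw [one_mul, ← sq_le_sq₀ (norm_nonneg _) (norm_nonneg _), norm_comb_sq]
    have := L.norm_comb_sq id a
    simp only [id] at this
    rw [comb, this]
    simp [h]
  refine ⟨(Finsupp.linearCombination ℝ (fun y => K.gen (ι y))).extendOfNorm L.comb, fun y => ?_⟩
  have := LinearMap.extendOfNorm_eq L.comb_dense ⟨1, hn⟩ (Finsupp.single y 1)
  simpa [comb] using this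

theorem existsUnique_restrict {Y : Type*} (L : ReproducingKernel Y) (K : ReproducingKernel X)
    (ι : Y → X) (h : ∀ y z, L y z = K (ι y) (ι z)) :
    ∃! R : K.H →L[ℝ] L.H, ∀ f y, R f y = f (ι y) := by
  obtain ⟨J, hJ⟩ := exists_embed L K ι h
  refine ⟨ContinuousLinearMap.adjoint J, fun f y => ?_, fun R hR => ?_⟩
  · rw [← inner_gen, ContinuousLinearMap.adjoint_inner_left, hJ, inner_gen]
  · ext f y
    rw [hR, ← inner_gen L, ContinuousLinearMap.adjoint_inner_left, hJ, inner_gen]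

/-- The subkernel `K_A = K|_{A × A}`. -/
def sub (K : ReproducingKernel X) (A : Set X) : ReproducingKernel A where
  toFun x y := K x y
  symm' x y := K.symm' x y
  nonneg' n α x := K.nonneg' n α (fun i => x i)

/-- The restriction map `f ↦ f|_A` from `ℋ(K)` to `ℋ(K_A)`. -/
noncomputable def restrict (K : ReproducingKernel X) (A : Set X) : K.H →L[ℝ] (K.sub A).H :=
  (existsUnique_restrict (K.sub A) K (fun a => (a : X)) (fun _ _ => rfl)).choose

theorem restrict_apply (K : ReproducingKernel X) (A : Set X) (f : K.H) (a : A) :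
    K.restrict A f a = f a :=
  (existsUnique_restrict (K.sub A) K (fun a => (a : X)) (fun _ _ => rfl)).choose_spec.1 f a

end ReproducingKernel

/-- A partially reproducing kernel on `Ω ⊆ X × X`: a function on `Ω` whose restriction to every
square `A × A ⊆ Ω` is a reproducing kernel on `A`. -/
structure PartialKernel {X : Type*} (Ω : Set (X × X)) where
  toFun : Ω → ℝ
  symm' : ∀ (A : Set X) (hA : A ×ˢ A ⊆ Ω) (x y : A),
    toFun ⟨(x, y), hA ⟨x.2, y.2⟩⟩ = toFun ⟨(y, x), hA ⟨y.2, x.2⟩⟩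
  nonneg' : ∀ (A : Set X) (hA : A ×ˢ A ⊆ Ω) (n : ℕ) (α : Fin n → ℝ) (x : Fin n → A),
    0 ≤ ∑ i, ∑ j, α i * α j * toFun ⟨(x i, x j), hA ⟨(x i).2, (x j).2⟩⟩

namespace PartialKernel

open ReproducingKernel

variable {X : Type*} {Ω : Set (X × X)}

/-- The reproducing kernel `K_A = K_Ω|_{A × A}` on a clique `A`. -/
def sub (P : PartialKernel Ω) (A : Set X) (hA : A ×ˢ A ⊆ Ω) : ReproducingKernel A where
  toFun x y := P.toFun ⟨(x, y), hA ⟨x.2, y.2⟩⟩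
  symm' := P.symm' A hA
  nonneg' := P.nonneg' A hA

/-- `K` is a completion of `K_Ω`: a reproducing kernel on `X` that restricts to `K_Ω` on `Ω`. -/
def IsCompletion (P : PartialKernel Ω) (K : ReproducingKernel X) : Prop :=
  ∀ p : Ω, K p.1.1 p.1.2 = P.toFun p

/-- For a completion `K` of `K_Ω` and a clique `A`, the map `f ↦ f|_A` from `ℋ(K)` to `ℋ(K_A)`,
where `K_A = K_Ω|_{A × A}`. -/
noncomputable def restrict (P : PartialKernel Ω) {K : ReproducingKernel X} (hK : P.IsCompletion K)
    (A : Set X) (hA : A ×ˢ A ⊆ Ω) : K.H →L[ℝ] (P.sub A hA).H :=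
  (existsUnique_restrict (P.sub A hA) K (fun a => (a : X))
    (fun y z => (hK ⟨(y, z), hA ⟨y.2, z.2⟩⟩).symm)).choose

theorem restrict_apply (P : PartialKernel Ω) {K : ReproducingKernel X} (hK : P.IsCompletion K)
    (A : Set X) (hA : A ×ˢ A ⊆ Ω) (f : K.H) (a : A) : P.restrict hK A hA f a = f a :=
  (existsUnique_restrict (P.sub A hA) K (fun a => (a : X))
    (fun y z => (hK ⟨(y, z), hA ⟨y.2, z.2⟩⟩).symm)).choose_spec.1 f a

theorem clique_left {A B : Set X} (h : (A ∪ B) ×ˢ (A ∪ B) ⊆ Ω) : A ×ˢ A ⊆ Ω :=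
  (Set.prod_mono Set.subset_union_left Set.subset_union_left).trans h

theorem clique_right {A B : Set X} (h : (A ∪ B) ×ˢ (A ∪ B) ⊆ Ω) : B ×ˢ B ⊆ Ω :=
  (Set.prod_mono Set.subset_union_right Set.subset_union_right).trans h

theorem existsUnique_contraction (P : PartialKernel Ω) (A B : Set X)
    (h : (A ∪ B) ×ˢ (A ∪ B) ⊆ Ω) :
    ∃! Φ : (P.sub A (clique_left h)).H →L[ℝ] (P.sub B (clique_right h)).H,
      ∀ (x : A) (y : B), Φ ((P.sub A (clique_left h)).gen x) y =
        P.toFun ⟨(x, y), h ⟨Or.inl x.2, Or.inr y.2⟩⟩ := by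
  obtain ⟨J, hJ⟩ := exists_embed (P.sub A (clique_left h)) (P.sub (A ∪ B) h)
    (fun a => ⟨a, Or.inl a.2⟩) (fun _ _ => rfl)
  obtain ⟨R, hR, -⟩ := existsUnique_restrict (P.sub B (clique_right h)) (P.sub (A ∪ B) h)
    (fun b => ⟨b, Or.inr b.2⟩) (fun _ _ => rfl)
  have key : ∀ (x : A) (y : B), (R.comp J) ((P.sub A (clique_left h)).gen x) y =
        P.toFun ⟨(x, y), h ⟨Or.inl x.2, Or.inr y.2⟩⟩ := by
    intro x y
    rw [ContinuousLinearMap.comp_apply, hR, hJ, gen_apply]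
    rfl
  refine ⟨R.comp J, key, fun Φ hΦ => clm_ext _ fun x => ?_⟩
  ext y
  rw [hΦ, key]

/-- The contraction map `Φ_{BA} : ℋ(K_A) → ℋ(K_B)`: the unique bounded linear map which sends the
generator `k_{x,A}` to the function `k_{x,B} : y ↦ K_Ω (x, y)` on `B`, for every `x ∈ A`. -/
noncomputable def contraction (P : PartialKernel Ω) (B A : Set X)
    (h : (A ∪ B) ×ˢ (A ∪ B) ⊆ Ω) :
    (P.sub A (clique_left h)).H →L[ℝ] (P.sub B (clique_right h)).H :=
  (P.existsUnique_contraction A B h).choose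

theorem contraction_gen_apply (P : PartialKernel Ω) (B A : Set X)
    (h : (A ∪ B) ×ˢ (A ∪ B) ⊆ Ω) (x : A) (y : B) :
    P.contraction B A h ((P.sub A (clique_left h)).gen x) y =
      P.toFun ⟨(x, y), h ⟨Or.inl x.2, Or.inr y.2⟩⟩ :=
  (P.existsUnique_contraction A B h).choose_spec.1 x y

end PartialKernel

/-- `S` separates `x` and `y` (both outside `S`) in the graph `(X, Ω)`: every path
`x = z₀, z₁, …, zₙ₊₁ = y` in `Ω` has some `z_k ∈ S` with `1 ≤ k ≤ n`. -/
def Separates {X : Type*} (Ω : Set (X × X)) (S : Set X) (x y : X) : Prop :=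
  x ∉ S ∧ y ∉ S ∧ ∀ (n : ℕ) (z : ℕ → X), z 0 = x → z (n + 1) = y →
    (∀ k ≤ n, (z k, z (k + 1)) ∈ Ω) → ∃ k, 1 ≤ k ∧ k ≤ n ∧ z k ∈ S

/-- A canonical completion `K⋆` of `K_Ω`: a completion with
`K⋆ (x, y) = ⟪k⋆_{x,S}, k⋆_{y,S}⟫` in `ℋ(K⋆|_{S × S})` whenever `S` separates `x` and `y` in `Ω`;
here `k⋆_{u,S}` is the function `v ↦ K⋆ (u, v)` on `S`. -/
def PartialKernel.IsCanonicalCompletion {X : Type*} {Ω : Set (X × X)} (P : PartialKernel Ω)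
    (K : ReproducingKernel X) : Prop :=
  P.IsCompletion K ∧ ∀ (x y : X) (S : Set X), Separates Ω S x y →
    K x y = ⟪K.restrict S (K.gen x), K.restrict S (K.gen y)⟫_ℝ

/-- A junction-tree representation of `Ω`: a tree `T` on the indices and sets `V j` that cover `X`,
whose squares have union `Ω`, such that `V i ∩ V k ⊆ V j` for `j` on the path in `T` from `i` to
`k`. -/
structure IsJunctionTree {X : Type*} (Ω : Set (X × X)) {n : ℕ} (T : SimpleGraph (Fin n))
    (V : Fin n → Set X) : Prop where
  isTree : T.IsTree
  iUnion_eq : ⋃ j, V j = Set.univ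
  iUnion_prod_eq : ⋃ j, V j ×ˢ V j = Ω
  inter_subset : ∀ (i k : Fin n) (w : T.Walk i k), w.IsPath → ∀ j ∈ w.support, V i ∩ V k ⊆ V j

namespace IsJunctionTree

variable {X : Type*} {Ω : Set (X × X)} {n : ℕ} {T : SimpleGraph (Fin n)} {V : Fin n → Set X}

/-- Such an `Ω` is a domain: it is symmetric and contains the diagonal. -/
theorem isDomain (hJ : IsJunctionTree Ω T V) :
    (∀ x y, (x, y) ∈ Ω ↔ (y, x) ∈ Ω) ∧ ∀ x, (x, x) ∈ Ω := by
  refine ⟨fun x y => ?_, fun x => ?_⟩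
  · simp only [← hJ.iUnion_prod_eq, Set.mem_iUnion, Set.mem_prod]
    exact exists_congr fun _ => and_comm
  · have : x ∈ ⋃ j, V j := hJ.iUnion_eq ▸ Set.mem_univ x
    simpa [← hJ.iUnion_prod_eq] using this

theorem clique (hJ : IsJunctionTree Ω T V) (j : Fin n) : V j ×ˢ V j ⊆ Ω := by
  rw [← hJ.iUnion_prod_eq]
  exact Set.subset_iUnion (fun j => V j ×ˢ V j) j

theorem clique_inter (hJ : IsJunctionTree Ω T V) (i j : Fin n) :
    (V i ∩ V j) ×ˢ (V i ∩ V j) ⊆ Ω :=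
  (Set.prod_mono Set.inter_subset_left Set.inter_subset_left).trans (hJ.clique i)

theorem clique_to_inter (hJ : IsJunctionTree Ω T V) (p q : Fin n) :
    (V q ∪ V p ∩ V q) ×ˢ (V q ∪ V p ∩ V q) ⊆ Ω := by
  rw [Set.union_eq_left.mpr Set.inter_subset_right]
  exact hJ.clique q

theorem clique_from_inter (hJ : IsJunctionTree Ω T V) (p q : Fin n) :
    (V p ∩ V q ∪ V p) ×ˢ (V p ∩ V q ∪ V p) ⊆ Ω := by
  rw [Set.union_eq_right.mpr Set.inter_subset_left]
  exact hJ.clique p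

/-- `Φ_{pq} = Φ_{V p, V p ∩ V q} Φ_{V p ∩ V q, V q} : ℋ(K_{V q}) → ℋ(K_{V p})`. -/
noncomputable def edgeMap (hJ : IsJunctionTree Ω T V) (P : PartialKernel Ω) (p q : Fin n) :
    (P.sub (V q) (hJ.clique q)).H →L[ℝ] (P.sub (V p) (hJ.clique p)).H :=
  (P.contraction (V p) (V p ∩ V q) (hJ.clique_from_inter p q)).comp
    (P.contraction (V p ∩ V q) (V q) (hJ.clique_to_inter p q))

/-- For a walk `i, i₁, …, iₖ, j` in `T`, the product
`Φ_{j iₖ} ⋯ Φ_{i₂ i₁} Φ_{i₁ i} : ℋ(K_{V i}) → ℋ(K_{V j})`; the identity for the walk of length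
zero. -/
noncomputable def walkMap (hJ : IsJunctionTree Ω T V) (P : PartialKernel Ω) :
    ∀ {i j : Fin n}, T.Walk i j →
      ((P.sub (V i) (hJ.clique i)).H →L[ℝ] (P.sub (V j) (hJ.clique j)).H)
  | i, _, SimpleGraph.Walk.nil => ContinuousLinearMap.id ℝ (P.sub (V i) (hJ.clique i)).H
  | i, _, SimpleGraph.Walk.cons (v := v) _ w => (hJ.walkMap P w).comp (hJ.edgeMap P v i)

end IsJunctionTree

/-! Write P_A for the orthogonal projection of ℋ(K) onto the closed span of the k_a, a ∈ A. A
completion is canonical exactly when it factors through the intersections along tree edges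
(`IsTreeMarkov`, `isCanonicalCompletion_iff`). Those intersections are separators, which is one
direction. Conversely, the Markov property gives ∑ P_{V j} - ∑ P_{V i ∩ V j} = id (`sum_proj`): for
x ∈ V r, root the tree at r; on k_x each bag other than V r cancels against its edge towards r, and
P_{V r} k_x = k_x remains. Pairing with f yields the norm formula, and truncating the sum to the
bags on one side of an arbitrary separator yields factorization there (`exists_cut`,
`eq_inner_proj`).

For any completion, the embeddings of the ℋ(K_{V q}) into ℋ(K) turn Φ_{pq} into P_{V p ∩ V q}
(`embed_edgeMap`). With the Markov property this gives the path formula, hence uniqueness.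

For existence, the path formula is taken as the definition (`treeKernel`). It does not depend on the
chosen bags, because transported functions agree on overlaps (`treeMap_apply_eq`). It is positive
because the same telescoping turns the quadratic form into a sum of squared norms over bags minus
one over edges, and each edge term is at most the term of its endpoint farther from the root
(`sum_inner_treeMap_nonneg`). -/

/-! ### Rooted trees and telescoping sums over edges. -/

namespace SimpleGraph.IsTree

variable {ι : Type*} {T : SimpleGraph ι}

/-- The unique path between two vertices of a tree. -/
noncomputable def pathBetween (hT : T.IsTree) (i j : ι) : T.Walk i j :=
  (hT.existsUnique_path i j).choose

theorem isPath_pathBetween (hT : T.IsTree) (i j : ι) : (hT.pathBetween i j).IsPath :=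
  (hT.existsUnique_path i j).choose_spec.1

theorem eq_pathBetween (hT : T.IsTree) {i j : ι} {w : T.Walk i j} (hw : w.IsPath) :
    w = hT.pathBetween i j :=
  (hT.existsUnique_path i j).choose_spec.2 w hw

/-- The neighbour of `j` on the path from `j` to `r`. -/
noncomputable def toward (hT : T.IsTree) (r j : ι) : ι := (hT.pathBetween j r).snd

theorem toward_eq_of_isPath_cons (hT : T.IsTree) {r j k : ι} {h : T.Adj j k} {w : T.Walk k r}
    (hw : (Walk.cons h w).IsPath) : hT.toward r j = k := by
  rw [toward, ← hT.eq_pathBetween hw, Walk.snd_cons]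

theorem exists_pathBetween_eq_cons (hT : T.IsTree) {r j : ι} (hj : j ≠ r) :
    ∃ h : T.Adj j (hT.toward r j),
      hT.pathBetween j r = Walk.cons h (hT.pathBetween (hT.toward r j) r) := by
  have hp := hT.isPath_pathBetween j r
  cases hw : hT.pathBetween j r with
  | nil => exact absurd rfl hj
  | @cons _ k _ h w =>
    rw [hw] at hp
    obtain rfl := hT.toward_eq_of_isPath_cons hp
    exact ⟨h, by rw [hT.eq_pathBetween hp.of_cons]⟩

/-- Either `p` lies on the path from `q` to `r` and is then its second vertex, or prepending `p` to
that path gives the path from `p`. -/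
theorem toward_eq_or_toward_eq (hT : T.IsTree) (r : ι) {p q : ι} (h : T.Adj p q) :
    (p ≠ r ∧ hT.toward r p = q) ∨ (q ≠ r ∧ hT.toward r q = p) := by
  by_cases hp : p ∈ (hT.pathBetween q r).support
  · right
    have := hT.isAcyclic.eq_snd_of_adj_start (hT.isPath_pathBetween q r) h.symm hp
    refine ⟨?_, this.symm⟩
    rintro rfl
    rw [← hT.eq_pathBetween (w := Walk.nil) (by simp)] at hp
    simp at hp
    exact h.ne hp
  · left
    have hc : (Walk.cons h (hT.pathBetween q r)).IsPath :=
      (hT.isPath_pathBetween q r).cons hp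
    refine ⟨?_, hT.toward_eq_of_isPath_cons hc⟩
    rintro rfl
    exact hp (Walk.end_mem_support _)

theorem toward_toward_ne (hT : T.IsTree) {r j : ι} (hj : j ≠ r) :
    hT.toward r (hT.toward r j) ≠ j := by
  intro hk
  obtain ⟨h, hw⟩ := hT.exists_pathBetween_eq_cons hj
  have hp := hT.isPath_pathBetween j r
  rw [hw, Walk.cons_isPath_iff] at hp
  apply hp.2
  have h2 : hT.toward r (hT.toward r j) ∈ (hT.pathBetween (hT.toward r j) r).support :=
    Walk.getVert_mem_support _ 1
  rwa [hk] at h2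

/-- In a tree with root `r`, summing over edges is summing over the vertices other than `r`. -/
theorem sum_edges_eq {n : ℕ} {T : SimpleGraph (Fin n)} [DecidableRel T.Adj] (hT : T.IsTree)
    (r : Fin n) {M : Type*} [AddCommMonoid M] (G : Fin n → Fin n → M)
    (hG : ∀ p q, G p q = G q p) :
    ∑ p : Fin n × Fin n with p.1 < p.2 ∧ T.Adj p.1 p.2, G p.1 p.2 =
      ∑ j ∈ Finset.univ.erase r, G j (hT.toward r j) := by
  symm
  refine Finset.sum_bij
    (fun j _ => if j < hT.toward r j then (j, hT.toward r j) else (hT.toward r j, j)) ?_ ?_ ?_ ?_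
  · intro j hj
    obtain ⟨h, -⟩ := hT.exists_pathBetween_eq_cons (Finset.ne_of_mem_erase hj)
    split_ifs with hlt
    · simp [hlt, h]
    · simp [h.symm, lt_of_le_of_ne (not_lt.mp hlt) h.ne']
  · intro j hj k hk hjk
    -- If one edge is listed forwards and the other backwards, `j` and `k` point at each other,
    -- which is impossible.
    have h1 := hT.toward_toward_ne (Finset.ne_of_mem_erase hj)
    split_ifs at hjk <;> simp only [Prod.mk.injEq] at hjk
    · exact hjk.1
    · exact absurd (by rw [hjk.2, ← hjk.1]) h1
    · exact absurd (by rw [hjk.1, ← hjk.2]) h1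
    · exact hjk.2
  · rintro ⟨p, q⟩ hpq
    simp only [Finset.mem_filter, Finset.mem_univ, true_and] at hpq
    rcases hT.toward_eq_or_toward_eq r hpq.2 with ⟨hr, h⟩ | ⟨hr, h⟩
    · exact ⟨p, by simp [hr], by simp [h, hpq.1]⟩
    · exact ⟨q, by simp [hr], by simp [h, hpq.1.not_gt]⟩
  · intro j hj
    split_ifs
    · rfl
    · exact hG _ _

/-- Each vertex other than the root cancels against its edge towards the root. The norm formula, the
cut and positivity of the kernel all rest on this or on `sum_edges_eq`. -/
theorem sum_sub_sum_edges {n : ℕ} {T : SimpleGraph (Fin n)} [DecidableRel T.Adj] (hT : T.IsTree)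
    (r : Fin n) {M : Type*} [AddCommGroup M] (F : Fin n → M) (G : Fin n → Fin n → M)
    (hG : ∀ p q, G p q = G q p) (hF : ∀ j, j ≠ r → F j = G j (hT.toward r j)) :
    ∑ j, F j - ∑ p : Fin n × Fin n with p.1 < p.2 ∧ T.Adj p.1 p.2, G p.1 p.2 = F r := by
  rw [hT.sum_edges_eq r G hG, ← Finset.add_sum_erase _ _ (Finset.mem_univ r),
    Finset.sum_congr rfl fun j hj => hF j (Finset.ne_of_mem_erase hj), add_sub_cancel_right]

end SimpleGraph.IsTree

/-! ### Tree edges give separators. -/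

namespace IsJunctionTree

variable {X : Type*} {Ω : Set (X × X)} {n : ℕ} {T : SimpleGraph (Fin n)} {V : Fin n → Set X}

theorem exists_mem (hJ : IsJunctionTree Ω T V) (x : X) : ∃ i, x ∈ V i := by
  have : x ∈ ⋃ j, V j := hJ.iUnion_eq ▸ Set.mem_univ x
  simpa using this

theorem mem_domain_iff (hJ : IsJunctionTree Ω T V) {x y : X} :
    (x, y) ∈ Ω ↔ ∃ j, x ∈ V j ∧ y ∈ V j := by
  simp [← hJ.iUnion_prod_eq]

/-- A point which lies in bags on both sides of an edge lies in both bags of that edge. -/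
theorem mem_inter_of_reachable (hJ : IsJunctionTree Ω T V) {p q j l : Fin n}
    (hj : (T.deleteEdges {s(p, q)}).Reachable p j) (hl : ¬(T.deleteEdges {s(p, q)}).Reachable p l)
    {x : X} (hxj : x ∈ V j) (hxl : x ∈ V l) : x ∈ V p ∩ V q := by
  have he : s(p, q) ∈ (hJ.isTree.pathBetween j l).edges := by
    by_contra he
    exact hl (hj.trans (SimpleGraph.reachable_deleteEdges_iff_exists_walk.mpr ⟨_, he⟩))
  have hp := hJ.isTree.isPath_pathBetween j l
  exact ⟨hJ.inter_subset j l _ hp p (SimpleGraph.Walk.fst_mem_support_of_mem_edges _ he) ⟨hxj, hxl⟩,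
    hJ.inter_subset j l _ hp q (SimpleGraph.Walk.snd_mem_support_of_mem_edges _ he) ⟨hxj, hxl⟩⟩

theorem separates_of_isPath (hJ : IsJunctionTree Ω T V) {i v j : Fin n} (h : T.Adj i v)
    {w : T.Walk v j} (hw : (SimpleGraph.Walk.cons h w).IsPath) {x y : X} (hx : x ∈ V i)
    (hy : y ∈ V j) (hxS : x ∉ V i ∩ V v) (hyS : y ∉ V i ∩ V v) : Separates Ω (V i ∩ V v) x y := by
  refine ⟨hxS, hyS, fun m z hz0 hz1 hz => ?_⟩
  by_contra! hS
  have hj : ¬(T.deleteEdges {s(i, v)}).Reachable i j := by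
    intro hij
    have hb := SimpleGraph.isAcyclic_iff_forall_adj_isBridge.mp hJ.isTree.isAcyclic h
    rw [SimpleGraph.isBridge_iff] at hb
    refine hb (hij.trans (SimpleGraph.Reachable.symm ?_))
    refine SimpleGraph.reachable_deleteEdges_iff_exists_walk.mpr ⟨w, fun he => ?_⟩
    exact ((SimpleGraph.Walk.cons_isPath_iff _ _).mp hw).2
      (SimpleGraph.Walk.fst_mem_support_of_mem_edges _ he)
  have hout : ∀ k ≤ m + 1, z k ∉ V i ∩ V v := by
    intro k hk
    rcases Nat.eq_zero_or_pos k with rfl | hk0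
    · rwa [hz0]
    · rcases Nat.lt_or_ge m k with hk' | hk'
      · rwa [le_antisymm hk hk', hz1]
      · exact hS k hk0 hk'
  -- Consecutive points share a bag; a path that avoids `V i ∩ V v` therefore never leaves the bags
  -- on the side of `i` after the edge is deleted.
  have hin : ∀ k ≤ m + 1, ∃ l, (T.deleteEdges {s(i, v)}).Reachable i l ∧ z k ∈ V l := by
    intro k
    induction k with
    | zero => exact fun _ => ⟨i, SimpleGraph.Reachable.refl _, hz0 ▸ hx⟩
    | succ k ih =>
      intro hk
      obtain ⟨l, hl, hzl⟩ := ih (by omega)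
      obtain ⟨l', hzl', hzl''⟩ := hJ.mem_domain_iff.mp (hz k (by omega))
      refine ⟨l', ?_, hzl''⟩
      by_contra hl'
      exact hout k (by omega) (hJ.mem_inter_of_reachable hl hl' hzl hzl')
  obtain ⟨l, hl, hzl⟩ := hin (m + 1) le_rfl
  exact hyS (hJ.mem_inter_of_reachable hl hj (hz1 ▸ hzl) hy)

end IsJunctionTree

/-! ### Projections and the Markov property along the tree. -/

namespace ReproducingKernel

variable {X : Type*}

/-- The orthogonal projection of `ℋ(K)` onto the closed span of the generators `k_a`, `a ∈ A`. -/
noncomputable def proj (K : ReproducingKernel X) (A : Set X) : K.H →L[ℝ] K.H :=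
  (ContinuousLinearMap.adjoint (K.restrict A)).comp (K.restrict A)

theorem inner_proj_left (K : ReproducingKernel X) (A : Set X) (f g : K.H) :
    ⟪K.proj A f, g⟫_ℝ = ⟪K.restrict A f, K.restrict A g⟫_ℝ := by
  rw [proj, ContinuousLinearMap.comp_apply, ContinuousLinearMap.adjoint_inner_left]

theorem inner_proj_right (K : ReproducingKernel X) (A : Set X) (f g : K.H) :
    ⟪f, K.proj A g⟫_ℝ = ⟪K.proj A f, g⟫_ℝ := by
  rw [real_inner_comm, inner_proj_left, inner_proj_left, real_inner_comm]

theorem restrict_gen (K : ReproducingKernel X) (A : Set X) (a : A) :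
    K.restrict A (K.gen a) = (K.sub A).gen a := by
  ext b
  rw [restrict_apply, gen_apply, gen_apply]
  rfl

theorem proj_apply_of_mem (K : ReproducingKernel X) {A : Set X} (f : K.H) {a : X} (ha : a ∈ A) :
    K.proj A f a = f a := by
  rw [← inner_gen, inner_proj_left, show K.restrict A (K.gen a) = _ from K.restrict_gen A ⟨a, ha⟩,
    inner_gen, restrict_apply]

theorem proj_gen_of_mem (K : ReproducingKernel X) {A : Set X} {a : X} (ha : a ∈ A) :
    K.proj A (K.gen a) = K.gen a := by
  ext b
  rw [← inner_gen, ← inner_proj_right, real_inner_comm, inner_gen, K.proj_apply_of_mem _ ha,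
    gen_apply, gen_apply, K.symm']

theorem proj_congr (K : ReproducingKernel X) {A : Set X} {f g : K.H} (h : ∀ a ∈ A, f a = g a) :
    K.proj A f = K.proj A g := by
  have : K.restrict A f = K.restrict A g := by
    ext a
    rw [restrict_apply, restrict_apply, h a a.2]
  rw [proj, ContinuousLinearMap.comp_apply, this, ContinuousLinearMap.comp_apply]

theorem proj_eq_zero (K : ReproducingKernel X) {A : Set X} {f : K.H} (h : ∀ a ∈ A, f a = 0) :
    K.proj A f = 0 := by
  rw [K.proj_congr (g := 0) (by simpa using h), map_zero]

/-- P_A P_B = P_A since P_A sees only values on A; taking adjoints reverses the order. -/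
theorem proj_proj_of_subset (K : ReproducingKernel X) {A B : Set X} (h : A ⊆ B) (f : K.H) :
    K.proj B (K.proj A f) = K.proj A f := by
  have hAB : ∀ g, K.proj A (K.proj B g) = K.proj A g := fun g =>
    K.proj_congr fun a ha => K.proj_apply_of_mem g (h ha)
  refine ext_inner_right ℝ fun g => ?_
  rw [← inner_proj_right, ← inner_proj_right, hAB, inner_proj_right]

/-- The maps `f ↦ f|_Y` into `ℋ(L)` and `ℋ(L')` are isometric to each other if `L = L'`. -/
theorem inner_eq_of_kernel_eq {Y : Type*} {L L' : ReproducingKernel Y} (h : ∀ x y, L x y = L' x y)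
    {f g : L.H} {f' g' : L'.H} (hf : ∀ y, f y = f' y) (hg : ∀ y, g y = g' y) :
    ⟪f, g⟫_ℝ = ⟪f', g'⟫_ℝ := by
  obtain rfl : L = L' := ReproducingKernel.ext (by funext x y; exact h x y)
  obtain rfl : f = f' := by ext y; exact hf y
  obtain rfl : g = g' := by ext y; exact hg y
  rfl

/-- Along any path `i, v, …, j` of `T`, the value of `K` on `V i × V j` factors through the
projection onto `V i ∩ V v`. -/
def IsTreeMarkov {n : ℕ} (K : ReproducingKernel X) (T : SimpleGraph (Fin n))
    (V : Fin n → Set X) : Prop :=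
  ∀ ⦃i v j : Fin n⦄ (h : T.Adj i v) (w : T.Walk v j), (SimpleGraph.Walk.cons h w).IsPath →
    ∀ x ∈ V i, ∀ y ∈ V j, K x y = ⟪K.proj (V i ∩ V v) (K.gen x), K.gen y⟫_ℝ

namespace IsTreeMarkov

variable {n : ℕ} {K : ReproducingKernel X} {T : SimpleGraph (Fin n)} {V : Fin n → Set X}

/-- This is the cancellation of a bag against its edge towards `r`: by the Markov property, k_x and
its projection onto the intersection agree on `V j`. -/
theorem proj_gen_eq (hK : K.IsTreeMarkov T V) (hT : T.IsTree) {r j : Fin n} (hj : j ≠ r) {x : X}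
    (hx : x ∈ V r) : K.proj (V j) (K.gen x) = K.proj (V j ∩ V (hT.toward r j)) (K.gen x) := by
  obtain ⟨h, hw⟩ := hT.exists_pathBetween_eq_cons hj
  rw [← K.proj_proj_of_subset (B := V j) Set.inter_subset_left]
  refine K.proj_congr fun y hy => ?_
  rw [gen_apply, K.symm', hK h _ (hw ▸ hT.isPath_pathBetween j r) y hy x hx, ← inner_proj_right,
    real_inner_comm, inner_gen]

theorem sum_proj [DecidableRel T.Adj] (hK : K.IsTreeMarkov T V) (hT : T.IsTree)
    (hV : ∀ x, ∃ i, x ∈ V i) (f : K.H) :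
    ∑ j, K.proj (V j) f -
      ∑ p : Fin n × Fin n with p.1 < p.2 ∧ T.Adj p.1 p.2, K.proj (V p.1 ∩ V p.2) f = f := by
  suffices h : ∑ j, K.proj (V j) - ∑ p : Fin n × Fin n with p.1 < p.2 ∧ T.Adj p.1 p.2,
      K.proj (V p.1 ∩ V p.2) = ContinuousLinearMap.id ℝ K.H by
    simpa [sum_apply] using congrArg (fun S => S f) h
  refine K.clm_ext fun x => ?_
  obtain ⟨r, hr⟩ := hV x
  have := hT.sum_sub_sum_edges r (fun j => K.proj (V j) (K.gen x))
    (fun p q => K.proj (V p ∩ V q) (K.gen x)) (fun p q => by rw [Set.inter_comm])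
    (fun j hj => hK.proj_gen_eq hT hj hr)
  rw [K.proj_gen_of_mem hr] at this
  simpa [sum_apply] using this

theorem norm_sq_eq [DecidableRel T.Adj] (hK : K.IsTreeMarkov T V) (hT : T.IsTree)
    (hV : ∀ x, ∃ i, x ∈ V i) (f : K.H) :
    ‖f‖ ^ 2 = ∑ j, ‖K.restrict (V j) f‖ ^ 2 -
      ∑ p : Fin n × Fin n with p.1 < p.2 ∧ T.Adj p.1 p.2, ‖K.restrict (V p.1 ∩ V p.2) f‖ ^ 2 := by
  rw [← real_inner_self_eq_norm_sq]
  conv_lhs => enter [2]; rw [← hK.sum_proj hT hV f]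
  simp_rw [inner_sub_left, sum_inner, inner_proj_left, real_inner_self_eq_norm_sq]

/-- If every `V j` lies in `A` or in `B`, and `f` vanishes on `A ∩ B`, then the function that is
`f` on `A` and zero on `B` is in `ℋ(K)`, and it is orthogonal to all `h` which vanish on `A`. -/
theorem exists_cut (hK : K.IsTreeMarkov T V) (hT : T.IsTree) (hV : ∀ x, ∃ i, x ∈ V i)
    {A B : Set X} (hAB : ∀ j, V j ⊆ A ∨ V j ⊆ B) (f : K.H) (hf : ∀ s ∈ A ∩ B, f s = 0) :
    ∃ g : K.H, (∀ x ∈ A, g x = f x) ∧ (∀ x ∈ B, g x = 0) ∧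
      ∀ h : K.H, (∀ x ∈ A, h x = 0) → ⟪g, h⟫_ℝ = 0 := by
  classical
  -- The decomposition of `f` from `sum_proj`, keeping only the terms supported in `A`.
  let F : Fin n → K.H := fun j => if V j ⊆ A then K.proj (V j) f else 0
  let G : Fin n → Fin n → K.H := fun p q => if V p ∩ V q ⊆ A then K.proj (V p ∩ V q) f else 0
  let g : K.H := ∑ j, F j - ∑ p : Fin n × Fin n with p.1 < p.2 ∧ T.Adj p.1 p.2, G p.1 p.2
  have hg : ∀ r, ∀ x ∈ V r, g x = F r x := by
    intro r x hx
    have key := hT.sum_sub_sum_edges r (fun j => ⟪F j, K.gen x⟫_ℝ)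
      (fun p q => ⟪G p q, K.gen x⟫_ℝ) (fun p q => by simp only [G, Set.inter_comm]) fun j hj => by
        by_cases hjA : V j ⊆ A
        · simp only [F, G, if_pos hjA, if_pos (Set.inter_subset_left.trans hjA)]
          rw [← inner_proj_right, hK.proj_gen_eq hT hj hx, inner_proj_right]
        · simp only [F, G, if_neg hjA, inner_zero_left]
          -- A dropped bag lies in `B`, so a kept edge at it lies in `A ∩ B`, where `f` vanishes;
          -- its term is zero and the telescoping survives.
          split_ifs with h
          · rw [K.proj_eq_zero fun a ha => hf a ⟨h ha, (hAB j).resolve_left hjA ha.1⟩,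
              inner_zero_left]
          · rw [inner_zero_left]
    rw [← inner_gen, ← inner_gen, ← key, inner_sub_left, sum_inner, sum_inner]
  have hgA : ∀ x ∈ A, g x = f x := by
    intro x hx
    obtain ⟨r, hr⟩ := hV x
    rw [hg r x hr]
    by_cases hrA : V r ⊆ A
    · simp only [F, if_pos hrA, K.proj_apply_of_mem f hr]
    · simp [F, if_neg hrA, hf x ⟨hx, (hAB r).resolve_left hrA hr⟩]
  refine ⟨g, hgA, fun x hx => ?_, fun h hh => ?_⟩
  · obtain ⟨r, hr⟩ := hV x
    rw [hg r x hr]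
    by_cases hrA : V r ⊆ A
    · simp only [F, if_pos hrA, K.proj_apply_of_mem f hr, hf x ⟨hrA hr, hx⟩]
    · simp [F, if_neg hrA]
  · have hF : ∀ j, ⟪F j, h⟫_ℝ = 0 := by
      intro j
      simp only [F]
      split_ifs with hj
      · rw [← inner_proj_right, K.proj_eq_zero fun a ha => hh a (hj ha), inner_zero_right]
      · rw [inner_zero_left]
    have hG : ∀ p q, ⟪G p q, h⟫_ℝ = 0 := by
      intro p q
      simp only [G]
      split_ifs with hj
      · rw [← inner_proj_right, K.proj_eq_zero fun a ha => hh a (hj ha), inner_zero_right]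
      · rw [inner_zero_left]
    simp only [g, inner_sub_left, sum_inner, hF, hG, Finset.sum_const_zero, sub_zero]

/-- Cut the residual f = k_x - P_{A ∩ B} k_x to g. Both f and g are orthogonal to f - g, which
vanishes on A, so f = g and f vanishes on B. -/
theorem eq_inner_proj (hK : K.IsTreeMarkov T V) (hT : T.IsTree) (hV : ∀ x, ∃ i, x ∈ V i)
    {A B : Set X} (hAB : ∀ j, V j ⊆ A ∨ V j ⊆ B) {x y : X} (hx : x ∈ A) (hy : y ∈ B) :
    K x y = ⟪K.proj (A ∩ B) (K.gen x), K.gen y⟫_ℝ := by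
  set f := K.gen x - K.proj (A ∩ B) (K.gen x) with hf
  have hf0 : ∀ s ∈ A ∩ B, f s = 0 := fun s hs => by
    rw [hf, RKHS.coe_sub, Pi.sub_apply, K.proj_apply_of_mem _ hs, sub_self]
  obtain ⟨g, hgA, hgB, hg⟩ := hK.exists_cut hT hV hAB f hf0
  have hA : ∀ a ∈ A, (f - g) a = 0 := fun a ha => by
    rw [RKHS.coe_sub, Pi.sub_apply, hgA a ha, sub_self]
  have h1 : ⟪f, f - g⟫_ℝ = 0 := by
    conv_lhs => rw [hf, inner_sub_left]
    rw [← inner_proj_right, K.proj_eq_zero fun a ha => hA a ha.1, inner_zero_right, real_inner_comm,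
      inner_gen, hA x hx, sub_zero]
  have h2 : f = g := by
    rw [← sub_eq_zero, ← inner_self_eq_zero (𝕜 := ℝ), inner_sub_left, h1, hg _ hA, sub_zero]
  have h3 : f y = 0 := by rw [h2, hgB y hy]
  rw [inner_gen, ← sub_eq_zero, ← K.gen_apply x y, ← Pi.sub_apply, ← RKHS.coe_sub, ← hf, h3]

end IsTreeMarkov

end ReproducingKernel

/-! ### Canonical completions are the Markov completions. -/

section

open ReproducingKernel

variable {X : Type*} {Ω : Set (X × X)} {n : ℕ} {T : SimpleGraph (Fin n)} {V : Fin n → Set X}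

/-- A separator splits `X` into two sets, with the separator as their intersection, such that
every pair in `Ω` lies in one of them. -/
theorem Separates.exists_sets {S : Set X} {x y : X} (hdiag : ∀ x, (x, x) ∈ Ω)
    (hS : Separates Ω S x y) :
    ∃ A B : Set X, A ∩ B = S ∧ x ∈ A ∧ y ∈ B ∧ ∀ a ∉ B, ∀ b, (a, b) ∈ Ω → b ∈ A := by
  -- The component of `x` outside `S`. Paths have at least one step, so the diagonal of `Ω` is what
  -- puts `x` itself in `C`.
  let C : Set X := {u | u ∉ S ∧ ∃ (m : ℕ) (z : ℕ → X), z 0 = x ∧ z (m + 1) = u ∧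
    (∀ k ≤ m, (z k, z (k + 1)) ∈ Ω) ∧ ∀ k, 1 ≤ k → k ≤ m → z k ∉ S}
  have hC : ∀ a ∈ C, ∀ b, (a, b) ∈ Ω → b ∉ S → b ∈ C := by
    rintro a ⟨haS, m, z, h0, h1, hz, hzS⟩ b hab hb
    refine ⟨hb, m + 1, fun k => if k ≤ m + 1 then z k else b, by simp [h0], by simp, ?_, ?_⟩
    · intro k hk
      rcases hk.lt_or_eq with hk | rfl
      · simpa [hk.le, Nat.lt_succ_iff.mp hk] using hz k (by omega)
      · simpa [h1] using hab
    · intro k hk1 hk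
      rcases hk.lt_or_eq with hk' | rfl
      · simpa [hk] using hzS k hk1 (by omega)
      · simpa [h1] using haS
  refine ⟨C ∪ S, Cᶜ, ?_, Or.inl ⟨hS.1, 0, fun _ => x, rfl, rfl, fun _ _ => hdiag x, by omega⟩,
    ?_, fun a ha b hab => ?_⟩
  · ext u
    have hu : u ∈ C → u ∉ S := fun h => h.1
    simp only [Set.mem_inter_iff, Set.mem_union, Set.mem_compl_iff]
    tauto
  · rintro ⟨-, m, z, h0, h1, hz, hzS⟩
    obtain ⟨k, hk1, hk, hkS⟩ := hS.2.2 m z h0 h1 hz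
    exact hzS k hk1 hk hkS
  · by_cases hb : b ∈ S
    · exact Or.inr hb
    · exact Or.inl (hC a (not_not.mp ha) b hab hb)

theorem IsJunctionTree.isCanonicalCompletion_iff (hJ : IsJunctionTree Ω T V) (P : PartialKernel Ω)
    (K : ReproducingKernel X) :
    P.IsCanonicalCompletion K ↔ P.IsCompletion K ∧ K.IsTreeMarkov T V := by
  refine and_congr_right fun _ => ⟨fun h i v j hiv w hw x hx y hy => ?_, fun h x y S hS => ?_⟩
  · by_cases hxS : x ∈ V i ∩ V v
    · rw [K.proj_gen_of_mem hxS, inner_gen_gen]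
    by_cases hyS : y ∈ V i ∩ V v
    · rw [← inner_proj_right, K.proj_gen_of_mem hyS, inner_gen_gen]
    rw [h x y _ (hJ.separates_of_isPath hiv hw hx hy hxS hyS), inner_proj_left]
  · obtain ⟨A, B, rfl, hx, hy, hAB⟩ := hS.exists_sets hJ.isDomain.2
    rw [← inner_proj_left]
    refine h.eq_inner_proj hJ.isTree hJ.exists_mem (fun j => ?_) hx hy
    by_contra! hj
    obtain ⟨a, ha, haB⟩ := Set.not_subset.mp hj.2
    exact hj.1 fun b hb => hAB a haB b (hJ.clique j ⟨ha, hb⟩)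

end

/-! ### Contractions between cliques, and embeddings into a completion. -/

namespace PartialKernel

open ReproducingKernel

variable {X : Type*} {Ω : Set (X × X)} (P : PartialKernel Ω)

theorem toFun_symm {A : Set X} (hA : A ×ˢ A ⊆ Ω) {x y : X} (hx : x ∈ A) (hy : y ∈ A)
    (hxy : (x, y) ∈ Ω) (hyx : (y, x) ∈ Ω) : P.toFun ⟨(x, y), hxy⟩ = P.toFun ⟨(y, x), hyx⟩ :=
  P.symm' A hA ⟨x, hx⟩ ⟨y, hy⟩

theorem contraction_gen_of_mem {A B : Set X} (h : (A ∪ B) ×ˢ (A ∪ B) ⊆ Ω) {x : X} (hA : x ∈ A)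
    (hB : x ∈ B) : P.contraction B A h ((P.sub A (clique_left h)).gen ⟨x, hA⟩) =
      (P.sub B (clique_right h)).gen ⟨x, hB⟩ := by
  ext y
  rw [contraction_gen_apply, gen_apply]
  rfl

/-- On generators both sides are values of K_Ω, so symmetry of the kernel makes Φ_{BA} and Φ_{AB}
adjoint. -/
theorem inner_contraction_left {A B : Set X} (h : (A ∪ B) ×ˢ (A ∪ B) ⊆ Ω)
    (h' : (B ∪ A) ×ˢ (B ∪ A) ⊆ Ω) (f : (P.sub A (clique_left h)).H)
    (g : (P.sub B (clique_right h)).H) :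
    ⟪P.contraction B A h f, g⟫_ℝ = ⟪f, P.contraction A B h' g⟫_ℝ := by
  have : P.contraction B A h = ContinuousLinearMap.adjoint (P.contraction A B h') := by
    refine clm_ext _ fun x => ?_
    ext y
    rw [contraction_gen_apply, ← inner_gen, ContinuousLinearMap.adjoint_inner_left,
      real_inner_comm, inner_gen]
    erw [contraction_gen_apply]
    exact P.toFun_symm h (Or.inl x.2) (Or.inr y.2) _ _
  rw [this, ContinuousLinearMap.adjoint_inner_left]

theorem contraction_apply_of_mem {A B : Set X} (h : (A ∪ B) ×ˢ (A ∪ B) ⊆ Ω) {x : X} (hA : x ∈ A)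
    (hB : x ∈ B) (f : (P.sub A (clique_left h)).H) :
    P.contraction B A h f ⟨x, hB⟩ = f ⟨x, hA⟩ := by
  have h' : (B ∪ A) ×ˢ (B ∪ A) ⊆ Ω := Set.union_comm A B ▸ h
  rw [← inner_gen, P.inner_contraction_left h h', P.contraction_gen_of_mem h' hB hA, inner_gen]

/-- Needed because `V p ∩ V q` and `V q ∩ V p` give different types. -/
theorem inner_sub_congr {A B : Set X} (hAB : A = B) {hA : A ×ˢ A ⊆ Ω} {hB : B ×ˢ B ⊆ Ω}
    {f g : (P.sub A hA).H} {f' g' : (P.sub B hB).H}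
    (hf : ∀ x (hx : x ∈ A) (hx' : x ∈ B), f ⟨x, hx⟩ = f' ⟨x, hx'⟩)
    (hg : ∀ x (hx : x ∈ A) (hx' : x ∈ B), g ⟨x, hx⟩ = g' ⟨x, hx'⟩) :
    ⟪f, g⟫_ℝ = ⟪f', g'⟫_ℝ := by
  subst hAB
  obtain rfl : f = f' := by ext y; exact hf y y.2 y.2
  obtain rfl : g = g' := by ext y; exact hg y y.2 y.2
  rfl

/-- Here Φ_{BA} is restriction and its adjoint Φ_{AB} preserves values on B, so ‖Φ_{AB} g‖ = ‖g‖ for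
g = Φ_{BA} f; Cauchy–Schwarz then bounds ‖g‖² = ⟪f, Φ_{AB} g⟫. -/
theorem norm_contraction_le {A B : Set X} (hBA : B ⊆ A) (h : (A ∪ B) ×ˢ (A ∪ B) ⊆ Ω)
    (f : (P.sub A (clique_left h)).H) : ‖P.contraction B A h f‖ ≤ ‖f‖ := by
  have h' : (B ∪ A) ×ˢ (B ∪ A) ⊆ Ω := Set.union_comm A B ▸ h
  set g := P.contraction B A h f with hg
  have h1 : ‖P.contraction A B h' g‖ = ‖g‖ := by
    rw [← sq_eq_sq₀ (norm_nonneg _) (norm_nonneg _), ← real_inner_self_eq_norm_sq,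
      ← real_inner_self_eq_norm_sq, P.inner_contraction_left h' h]
    congr 1
    ext y
    rw [P.contraction_apply_of_mem h (hBA y.2) y.2, P.contraction_apply_of_mem h' y.2 (hBA y.2)]
  have h2 : ‖g‖ * ‖g‖ ≤ ‖f‖ * ‖g‖ := by
    conv_rhs => rw [← h1]
    rw [← real_inner_self_eq_norm_mul_norm]
    conv_lhs => rw [hg]
    rw [P.inner_contraction_left h h']
    exact real_inner_le_norm _ _
  rcases (norm_nonneg g).eq_or_lt with h0 | h0
  · rw [← h0]
    exact norm_nonneg f
  · exact le_of_mul_le_mul_right h2 h0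

section Completion

variable {K : ReproducingKernel X} (hK : P.IsCompletion K)

theorem restrict_gen (A : Set X) (hA : A ×ˢ A ⊆ Ω) {a : X} (ha : a ∈ A) :
    P.restrict hK A hA (K.gen a) = (P.sub A hA).gen ⟨a, ha⟩ := by
  ext b
  rw [restrict_apply, gen_apply, gen_apply, hK ⟨(a, b), hA ⟨ha, b.2⟩⟩]
  rfl

/-- The adjoint of the restriction map `ℋ(K) → ℋ(K_A)`. -/
noncomputable def embed (A : Set X) (hA : A ×ˢ A ⊆ Ω) : (P.sub A hA).H →L[ℝ] K.H :=
  ContinuousLinearMap.adjoint (P.restrict hK A hA)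

theorem inner_embed_left (A : Set X) (hA : A ×ˢ A ⊆ Ω) (f : (P.sub A hA).H) (g : K.H) :
    ⟪P.embed hK A hA f, g⟫_ℝ = ⟪f, P.restrict hK A hA g⟫_ℝ := by
  rw [embed, ContinuousLinearMap.adjoint_inner_left]

theorem embed_apply_of_mem {A : Set X} (hA : A ×ˢ A ⊆ Ω) (f : (P.sub A hA).H) {a : X}
    (ha : a ∈ A) : P.embed hK A hA f a = f ⟨a, ha⟩ := by
  rw [← inner_gen, inner_embed_left, P.restrict_gen hK A hA ha, inner_gen]

theorem embed_gen {A : Set X} (hA : A ×ˢ A ⊆ Ω) (a : A) :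
    P.embed hK A hA ((P.sub A hA).gen a) = K.gen a := by
  ext y
  rw [← inner_gen, inner_embed_left, real_inner_comm, inner_gen, restrict_apply, gen_apply,
    gen_apply, K.symm']

theorem norm_restrict (A : Set X) (hA : A ×ˢ A ⊆ Ω) (f : K.H) :
    ‖P.restrict hK A hA f‖ = ‖K.restrict A f‖ := by
  rw [← sq_eq_sq₀ (norm_nonneg _) (norm_nonneg _), ← real_inner_self_eq_norm_sq,
    ← real_inner_self_eq_norm_sq]
  refine inner_eq_of_kernel_eq (fun x y : A => (hK ⟨(x, y), hA ⟨x.2, y.2⟩⟩).symm) ?_ ?_ <;>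
  · intro y
    rw [restrict_apply, ReproducingKernel.restrict_apply]

end Completion

end PartialKernel

/-! ### Transport along tree paths and the kernel it defines. -/

namespace IsJunctionTree

open ReproducingKernel PartialKernel

variable {X : Type*} {Ω : Set (X × X)} {n : ℕ} {T : SimpleGraph (Fin n)} {V : Fin n → Set X}
  (hJ : IsJunctionTree Ω T V) (P : PartialKernel Ω)

theorem inner_edgeMap_eq_inner_contraction (p q : Fin n) (f : (P.sub (V q) (hJ.clique q)).H)
    (g : (P.sub (V p) (hJ.clique p)).H) :
    ⟪hJ.edgeMap P p q f, g⟫_ℝ = ⟪P.contraction (V p ∩ V q) (V q) (hJ.clique_to_inter p q) f,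
      P.contraction (V p ∩ V q) (V p)
        (Set.union_comm (V p) (V p ∩ V q) ▸ hJ.clique_from_inter p q) g⟫_ℝ := by
  rw [edgeMap, ContinuousLinearMap.comp_apply, P.inner_contraction_left]

theorem inner_edgeMap_left (p q : Fin n) (f : (P.sub (V q) (hJ.clique q)).H)
    (g : (P.sub (V p) (hJ.clique p)).H) :
    ⟪hJ.edgeMap P p q f, g⟫_ℝ = ⟪f, hJ.edgeMap P q p g⟫_ℝ := by
  rw [real_inner_comm (hJ.edgeMap P q p g) f, inner_edgeMap_eq_inner_contraction,
    inner_edgeMap_eq_inner_contraction, real_inner_comm]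
  refine P.inner_sub_congr (Set.inter_comm _ _) ?_ ?_ <;> intro x hx hx'
  · rw [P.contraction_apply_of_mem _ hx.1 hx, P.contraction_apply_of_mem _ hx.1 hx']
  · rw [P.contraction_apply_of_mem _ hx.2 hx, P.contraction_apply_of_mem _ hx.2 hx']

theorem edgeMap_apply_of_mem {p q : Fin n} (f : (P.sub (V q) (hJ.clique q)).H) {x : X}
    (hp : x ∈ V p) (hq : x ∈ V q) : hJ.edgeMap P p q f ⟨x, hp⟩ = f ⟨x, hq⟩ :=
  (P.contraction_apply_of_mem (hJ.clique_from_inter p q) (A := V p ∩ V q) ⟨hp, hq⟩ hp _).trans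
    (P.contraction_apply_of_mem (hJ.clique_to_inter p q) hq ⟨hp, hq⟩ f)

theorem walkMap_append {i j k : Fin n} (w : T.Walk i j) (w' : T.Walk j k)
    (f : (P.sub (V i) (hJ.clique i)).H) :
    hJ.walkMap P (w.append w') f = hJ.walkMap P w' (hJ.walkMap P w f) := by
  induction w with
  | nil => rfl
  | cons h w ih => exact ih w' _

theorem inner_walkMap_left {i j : Fin n} (w : T.Walk i j) (f : (P.sub (V i) (hJ.clique i)).H)
    (g : (P.sub (V j) (hJ.clique j)).H) :
    ⟪hJ.walkMap P w f, g⟫_ℝ = ⟪f, hJ.walkMap P w.reverse g⟫_ℝ := by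
  induction w with
  | nil => rfl
  | @cons i v j h w ih =>
    rw [SimpleGraph.Walk.reverse_cons, walkMap_append]
    exact (ih _ g).trans (hJ.inner_edgeMap_left P v i _ _)

/-- The product of the maps `edgeMap` along the path from `i` to `j`. -/
noncomputable def treeMap (i j : Fin n) :
    (P.sub (V i) (hJ.clique i)).H →L[ℝ] (P.sub (V j) (hJ.clique j)).H :=
  hJ.walkMap P (hJ.isTree.pathBetween i j)

theorem treeMap_self (i : Fin n) (f : (P.sub (V i) (hJ.clique i)).H) :
    hJ.treeMap P i i f = f := by
  rw [treeMap, ← hJ.isTree.eq_pathBetween (w := SimpleGraph.Walk.nil) (by simp)]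
  rfl

theorem treeMap_eq_of_isPath_cons {i v j : Fin n} {h : T.Adj i v} {w : T.Walk v j}
    (hw : (SimpleGraph.Walk.cons h w).IsPath) (f : (P.sub (V i) (hJ.clique i)).H) :
    hJ.treeMap P i j f = hJ.treeMap P v j (hJ.edgeMap P v i f) := by
  rw [treeMap, treeMap, ← hJ.isTree.eq_pathBetween hw, ← hJ.isTree.eq_pathBetween hw.of_cons]
  rfl

theorem inner_treeMap_left (i j : Fin n) (f : (P.sub (V i) (hJ.clique i)).H)
    (g : (P.sub (V j) (hJ.clique j)).H) :
    ⟪hJ.treeMap P i j f, g⟫_ℝ = ⟪f, hJ.treeMap P j i g⟫_ℝ := by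
  rw [treeMap, treeMap, inner_walkMap_left,
    hJ.isTree.eq_pathBetween (hJ.isTree.isPath_pathBetween i j).reverse]

/-- `walkMap` peels off the first edge; passing to the adjoint reverses the path and peels off the
last. -/
theorem treeMap_eq_edgeMap {i j : Fin n} (hj : j ≠ i) (f : (P.sub (V i) (hJ.clique i)).H) :
    hJ.treeMap P i j f =
      hJ.edgeMap P j (hJ.isTree.toward i j) (hJ.treeMap P i (hJ.isTree.toward i j) f) := by
  obtain ⟨h, hw⟩ := hJ.isTree.exists_pathBetween_eq_cons hj
  refine ext_inner_right ℝ fun g => ?_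
  rw [inner_treeMap_left, hJ.treeMap_eq_of_isPath_cons P (hw ▸ hJ.isTree.isPath_pathBetween j i),
    inner_edgeMap_left, inner_treeMap_left]

/-- All bags between `p` and `q` contain `x`, so one edge at a time suffices. Across an edge, the
transport to the endpoint farther from `i` is `edgeMap` of the other, which keeps values on the
intersection. -/
theorem treeMap_apply_eq (i : Fin n) (f : (P.sub (V i) (hJ.clique i)).H) {p q : Fin n} {x : X}
    (hp : x ∈ V p) (hq : x ∈ V q) : hJ.treeMap P i p f ⟨x, hp⟩ = hJ.treeMap P i q f ⟨x, hq⟩ := by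
  have key : ∀ {p q : Fin n} (w : T.Walk p q), (∀ l ∈ w.support, x ∈ V l) →
      ∀ (hp : x ∈ V p) (hq : x ∈ V q),
        hJ.treeMap P i p f ⟨x, hp⟩ = hJ.treeMap P i q f ⟨x, hq⟩ := by
    intro p q w
    induction w with
    | nil => exact fun _ _ _ => rfl
    | @cons p v q h w ih =>
      intro hs hp hq
      have hv : x ∈ V v := hs v (by simp)
      rw [← ih (fun l hl => hs l (by simp [hl])) hv hq]
      rcases hJ.isTree.toward_eq_or_toward_eq i h with ⟨hi, rfl⟩ | ⟨hi, rfl⟩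
      · rw [hJ.treeMap_eq_edgeMap P hi, edgeMap_apply_of_mem]
      · rw [hJ.treeMap_eq_edgeMap P hi, edgeMap_apply_of_mem]
  exact key _ (fun l hl => hJ.inter_subset p q _ (hJ.isTree.isPath_pathBetween p q) l hl ⟨hp, hq⟩)
    hp hq

/-- The restriction map from the functions on `V p` to those on `V p ∩ V q`. -/
noncomputable def toInter (p q : Fin n) : (P.sub (V p) (hJ.clique p)).H →L[ℝ]
    (P.sub (V p ∩ V q) (hJ.clique_inter p q)).H :=
  P.contraction (V p ∩ V q) (V p) (Set.union_comm (V p) (V p ∩ V q) ▸ hJ.clique_from_inter p q)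

theorem toInter_apply (p q : Fin n) (f : (P.sub (V p) (hJ.clique p)).H) {x : X}
    (hx : x ∈ V p ∩ V q) : hJ.toInter P p q f ⟨x, hx⟩ = f ⟨x, hx.1⟩ :=
  P.contraction_apply_of_mem _ hx.1 hx f

/-- Rooted at `i`, everything cancels except bag `i`. The left side is a single form for all `i`,
`k`, so sums of vectors from different bags can be collected in it. -/
theorem inner_treeMap_eq_sum [DecidableRel T.Adj] (i k : Fin n)
    (f : (P.sub (V i) (hJ.clique i)).H) (g : (P.sub (V k) (hJ.clique k)).H) :
    ∑ j, ⟪hJ.treeMap P i j f, hJ.treeMap P k j g⟫_ℝ -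
      ∑ p : Fin n × Fin n with p.1 < p.2 ∧ T.Adj p.1 p.2,
        ⟪hJ.toInter P p.1 p.2 (hJ.treeMap P i p.1 f),
          hJ.toInter P p.1 p.2 (hJ.treeMap P k p.1 g)⟫_ℝ = ⟪f, hJ.treeMap P k i g⟫_ℝ := by
  rw [hJ.isTree.sum_sub_sum_edges i (fun j => ⟪hJ.treeMap P i j f, hJ.treeMap P k j g⟫_ℝ)
    (fun p q => ⟪hJ.toInter P p q (hJ.treeMap P i p f), hJ.toInter P p q (hJ.treeMap P k p g)⟫_ℝ),
    treeMap_self]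
  · intro p q
    refine P.inner_sub_congr (Set.inter_comm _ _) ?_ ?_ <;> intro x hx hx' <;>
      rw [toInter_apply, toInter_apply] <;> exact hJ.treeMap_apply_eq P _ _ _ _
  · intro j hj
    conv_lhs => rw [hJ.treeMap_eq_edgeMap P hj, inner_edgeMap_eq_inner_contraction]
    refine P.inner_sub_congr rfl ?_ ?_ <;> intro x hx hx'
    · rw [toInter_apply, P.contraction_apply_of_mem _ hx.2 hx]
      exact hJ.treeMap_apply_eq P _ _ _ _
    · rfl

theorem sum_inner_treeMap_nonneg {m : ℕ} (c : Fin m → Fin n)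
    (u : ∀ a, (P.sub (V (c a)) (hJ.clique (c a))).H) :
    0 ≤ ∑ a, ∑ b, ⟪u a, hJ.treeMap P (c b) (c a) (u b)⟫_ℝ := by
  classical
  obtain ⟨r⟩ := hJ.isTree.connected.nonempty
  -- All vectors transported to bag `j` and added; these sums still agree on overlaps.
  let z : ∀ j, (P.sub (V j) (hJ.clique j)).H := fun j => ∑ a, hJ.treeMap P (c a) j (u a)
  have hz : ∑ a, ∑ b, ⟪u a, hJ.treeMap P (c b) (c a) (u b)⟫_ℝ = ∑ j, ‖z j‖ ^ 2 -
      ∑ p : Fin n × Fin n with p.1 < p.2 ∧ T.Adj p.1 p.2, ‖hJ.toInter P p.1 p.2 (z p.1)‖ ^ 2 := by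
    rw [Finset.sum_congr rfl fun a _ => Finset.sum_congr rfl fun b _ =>
      (hJ.inner_treeMap_eq_sum P (c a) (c b) (u a) (u b)).symm]
    simp_rw [Finset.sum_sub_distrib, ← real_inner_self_eq_norm_sq]
    congr 1
    · refine ((Finset.sum_congr rfl fun a _ => Finset.sum_comm).trans Finset.sum_comm).trans ?_
      simp_rw [z, sum_inner, inner_sum]
    · refine ((Finset.sum_congr rfl fun a _ => Finset.sum_comm).trans Finset.sum_comm).trans ?_
      simp_rw [z, map_sum, sum_inner, inner_sum]
  have hsymm : ∀ p q, ‖hJ.toInter P p q (z p)‖ ^ 2 = ‖hJ.toInter P q p (z q)‖ ^ 2 := by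
    intro p q
    simp_rw [← real_inner_self_eq_norm_sq]
    have : ∀ x (hp : x ∈ V p) (hq : x ∈ V q), z p ⟨x, hp⟩ = z q ⟨x, hq⟩ := by
      intro x hp hq
      simp only [z, ← inner_gen, sum_inner]
      simp only [inner_gen]
      exact Finset.sum_congr rfl fun a _ => hJ.treeMap_apply_eq P _ _ _ _
    refine P.inner_sub_congr (Set.inter_comm _ _) ?_ ?_ <;> intro x hx hx' <;>
      rw [toInter_apply, toInter_apply] <;> exact this _ _ _
  rw [hz, hJ.isTree.sum_edges_eq r (fun p q => ‖hJ.toInter P p q (z p)‖ ^ 2) hsymm, sub_nonneg]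
  calc ∑ j ∈ Finset.univ.erase r, ‖hJ.toInter P j (hJ.isTree.toward r j) (z j)‖ ^ 2
      ≤ ∑ j ∈ Finset.univ.erase r, ‖z j‖ ^ 2 := Finset.sum_le_sum fun j _ =>
        pow_le_pow_left₀ (norm_nonneg _) (P.norm_contraction_le Set.inter_subset_left _ _) 2
    _ ≤ ∑ j, ‖z j‖ ^ 2 :=
        Finset.sum_le_sum_of_subset_of_nonneg (Finset.subset_univ _) fun _ _ _ => by positivity

/-- The reproducing kernel whose values are transported along the paths of the junction tree. -/
noncomputable def treeKernel : ReproducingKernel X :=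
  let c : X → Fin n := fun x => (hJ.exists_mem x).choose
  let hc : ∀ x, x ∈ V (c x) := fun x => (hJ.exists_mem x).choose_spec
  { toFun := fun x y => ⟪hJ.treeMap P (c x) (c y) ((P.sub _ (hJ.clique (c x))).gen ⟨x, hc x⟩),
      (P.sub _ (hJ.clique (c y))).gen ⟨y, hc y⟩⟫_ℝ
    symm' := fun x y => by rw [inner_treeMap_left, real_inner_comm]
    nonneg' := fun m α x => by
      refine (hJ.sum_inner_treeMap_nonneg P (fun a => c (x a))
        (fun a => α a • (P.sub _ (hJ.clique (c (x a)))).gen ⟨x a, hc (x a)⟩)).trans_eq ?_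
      refine Finset.sum_congr rfl fun a _ => Finset.sum_congr rfl fun b _ => ?_
      rw [map_smul, real_inner_smul_left, real_inner_smul_right, inner_treeMap_left, mul_assoc,
        real_inner_comm] }

theorem treeKernel_apply {i j : Fin n} {x y : X} (hx : x ∈ V i) (hy : y ∈ V j) :
    hJ.treeKernel P x y = ⟪hJ.treeMap P i j ((P.sub _ (hJ.clique i)).gen ⟨x, hx⟩),
      (P.sub _ (hJ.clique j)).gen ⟨y, hy⟩⟫_ℝ := by
  change ⟪hJ.treeMap P _ _ _, _⟫_ℝ = _
  rw [inner_gen, hJ.treeMap_apply_eq P _ _ _ hy, ← inner_gen, inner_treeMap_left, real_inner_comm,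
    inner_gen, hJ.treeMap_apply_eq P _ _ _ hx, ← inner_gen, inner_treeMap_left, real_inner_comm]

theorem treeKernel_isCompletion : P.IsCompletion (hJ.treeKernel P) := by
  rintro ⟨⟨x, y⟩, hxy⟩
  obtain ⟨j, hx, hy⟩ := hJ.mem_domain_iff.mp hxy
  rw [hJ.treeKernel_apply P hx hy, treeMap_self, inner_gen_gen]
  rfl

/-! ### Transport as projection inside a completion. -/

variable {K : ReproducingKernel X} (hK : P.IsCompletion K)

theorem embed_edgeMap (p q : Fin n) (f : (P.sub (V q) (hJ.clique q)).H) :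
    P.embed hK (V p) (hJ.clique p) (hJ.edgeMap P p q f) =
      K.proj (V p ∩ V q) (P.embed hK (V q) (hJ.clique q) f) := by
  ext y
  rw [← inner_gen, ← inner_gen, inner_embed_left, inner_edgeMap_eq_inner_contraction,
    inner_proj_left]
  refine inner_eq_of_kernel_eq
    (fun x y : ↥(V p ∩ V q) => (hK ⟨(x, y), hJ.clique_inter p q ⟨x.2, y.2⟩⟩).symm) ?_ ?_ <;> rintro ⟨x, hx⟩
  · rw [P.contraction_apply_of_mem _ hx.2 hx, ReproducingKernel.restrict_apply,
      P.embed_apply_of_mem hK _ _ hx.2]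
  · rw [P.contraction_apply_of_mem _ hx.1 hx, ReproducingKernel.restrict_apply,
      PartialKernel.restrict_apply]

/-- The first edge inserts a projection onto `V v ∩ V i`. Moved onto k_y it is invisible on `V i`,
by the Markov property, hence also to the embedded `f`. -/
theorem walkMap_apply (hM : K.IsTreeMarkov T V) {i j : Fin n} {w : T.Walk i j} (hw : w.IsPath)
    (f : (P.sub (V i) (hJ.clique i)).H) (y : V j) :
    hJ.walkMap P w f y = P.embed hK (V i) (hJ.clique i) f y := by
  induction w with
  | nil => exact (P.embed_apply_of_mem hK _ f y.2).symm
  | @cons i v j h w ih =>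
    refine (ih hw.of_cons (hJ.edgeMap P v i f) y).trans ?_
    rw [embed_edgeMap, ← inner_gen, ← inner_proj_right, inner_embed_left, ← inner_gen K,
      inner_embed_left]
    congr 1
    ext x
    rw [PartialKernel.restrict_apply, PartialKernel.restrict_apply, Set.inter_comm, ← inner_gen,
      real_inner_comm, inner_proj_right, ← hM h w hw x x.2 y y.2, gen_apply, K.symm']

/-- The first edge map of the path is, after embedding, exactly the projection required; the
remaining transports, moved to the other side, give k_y restricted to `V v`. -/
theorem treeKernel_isTreeMarkov : (hJ.treeKernel P).IsTreeMarkov T V := by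
  intro i v j h w hw x hx y hy
  have hK := hJ.treeKernel_isCompletion P
  have hy' : hJ.treeMap P j v ((P.sub _ (hJ.clique j)).gen ⟨y, hy⟩) =
      P.restrict hK (V v) (hJ.clique v) ((hJ.treeKernel P).gen y) := by
    ext z
    rw [PartialKernel.restrict_apply, gen_apply, hJ.treeKernel_apply P hy z.2, inner_gen]
  rw [hJ.treeKernel_apply P hx hy, hJ.treeMap_eq_of_isPath_cons P hw, inner_treeMap_left, hy',
    ← inner_embed_left, embed_edgeMap, Set.inter_comm, embed_gen]

theorem apply_eq_inner_walkMap (hK : P.IsCompletion K) (hM : K.IsTreeMarkov T V)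
    {i j : Fin n} (x : V i) (y : V j) {w : T.Walk i j} (hw : w.IsPath) :
    K x y = ⟪hJ.walkMap P w ((P.sub (V i) (hJ.clique i)).gen x),
      (P.sub (V j) (hJ.clique j)).gen y⟫_ℝ := by
  rw [inner_gen, hJ.walkMap_apply P hK hM hw, embed_gen, gen_apply]

end IsJunctionTree

theorem mainTheorem11 {X : Type*} {Ω : Set (X × X)} (P : PartialKernel Ω) {n : ℕ}
    (T : SimpleGraph (Fin n)) [DecidableRel T.Adj] (V : Fin n → Set X)
    (hJ : IsJunctionTree Ω T V) :
    (∃! K : ReproducingKernel X, P.IsCanonicalCompletion K) ∧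
    ∀ (K : ReproducingKernel X) (hK : P.IsCanonicalCompletion K),
      (∀ f : K.H, ‖f‖ ^ 2 =
        ∑ j, ‖P.restrict hK.1 (V j) (hJ.clique j) f‖ ^ 2 -
        ∑ p : Fin n × Fin n with p.1 < p.2 ∧ T.Adj p.1 p.2,
          ‖P.restrict hK.1 (V p.1 ∩ V p.2) (hJ.clique_inter p.1 p.2) f‖ ^ 2) ∧
      ∀ (i j : Fin n) (x : V i) (y : V j) (w : T.Walk i j), w.IsPath →
        K x y = ⟪hJ.walkMap P w ((P.sub (V i) (hJ.clique i)).gen x),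
          (P.sub (V j) (hJ.clique j)).gen y⟫_ℝ := by
  have formula : ∀ K : ReproducingKernel X, P.IsCanonicalCompletion K →
      ∀ (i j : Fin n) (x : V i) (y : V j) (w : T.Walk i j), w.IsPath →
        K x y = ⟪hJ.walkMap P w ((P.sub (V i) (hJ.clique i)).gen x),
          (P.sub (V j) (hJ.clique j)).gen y⟫_ℝ := fun K hK i j x y w hw =>
    hJ.apply_eq_inner_walkMap P hK.1 ((hJ.isCanonicalCompletion_iff P K).mp hK).2 x y hw
  have canonical : P.IsCanonicalCompletion (hJ.treeKernel P) :=
    (hJ.isCanonicalCompletion_iff P _).mpr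
      ⟨hJ.treeKernel_isCompletion P, hJ.treeKernel_isTreeMarkov P⟩
  refine ⟨⟨_, canonical, fun K hK => ?_⟩, fun K hK => ⟨fun f => ?_, formula K hK⟩⟩
  · ext x y
    obtain ⟨i, hi⟩ := hJ.exists_mem x
    obtain ⟨j, hj⟩ := hJ.exists_mem y
    have hw := hJ.isTree.isPath_pathBetween i j
    exact (formula K hK i j ⟨x, hi⟩ ⟨y, hj⟩ _ hw).trans
      (formula _ canonical i j ⟨x, hi⟩ ⟨y, hj⟩ _ hw).symm
  · simp_rw [P.norm_restrict hK.1]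
    exact ((hJ.isCanonicalCompletion_iff P K).mp hK).2.norm_sq_eq hJ.isTree hJ.exists_mem f
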